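/- Let $\Sigma$ be a finite alphabet. A nonempty word $u\in\Sigma^*$ is called periodic if $u=v^k$ for some word $v$ and some $k\ge 2$, and primitive otherwise; $\mathrm{Per}$ denotes the set of all periodic words over $\Sigma$. The root of a nonempty word $p$ is the unique primitive word $q$ such that $p$ is a power of $q$, and the root of a language $L\subseteq\Sigma^*$ is the set of the roots of all nonempty words of $L$. For $n\in\mathbb{N}$ let $L^{(n)}=\{p^n : p\in L\}$. Theorem. Let $L\subseteq\Sigma^*$ be a context-free language and let $n\ge 2$ be a natural number such that $L^{(n)}$ is context-free. If $n\ge 3$, then $L$ is regular and has a finite root. If $n=2$, then $L\cap\mathrm{Per}$ is regular and has a finite root. -/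

import Mathlib

namespace PrimitiveWords

/-- The power `p ^ n` of a word: the concatenation of `n` copies of `p` (empty if `n = 0`). -/
def wordPow {α : Type*} (p : List α) (n : ℕ) : List α :=
  (List.replicate n p).flatten

/-- A nonempty word is periodic if it is `v ^ n` for some word `v` and some `n ≥ 2`. -/
def IsPeriodic {α : Type*} (u : List α) : Prop :=
  u ≠ [] ∧ ∃ (v : List α) (n : ℕ), 2 ≤ n ∧ u = wordPow v n

/-- A primitive word is a nonempty word that is not periodic. -/
def IsPrimitive {α : Type*} (u : List α) : Prop :=
  u ≠ [] ∧ ¬ IsPeriodic u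

/-- `q` is the root of the nonempty word `p`: `q` is primitive and `p` is a power of `q`. -/
def IsRootOf {α : Type*} (q p : List α) : Prop :=
  IsPrimitive q ∧ ∃ n : ℕ, p = wordPow q n

/-- `Per`, the language of all periodic words. -/
def Per (α : Type*) : Language α :=
  {u : List α | IsPeriodic u}

/-- The root of a language: the set of the roots of its nonempty words. -/
def rootSet {α : Type*} (L : Language α) : Language α :=
  {q : List α | ∃ p ∈ L, p ≠ [] ∧ IsRootOf q p}

/-- `L^(n) = {p ^ n : p ∈ L}`, the set of the `n`-th powers of the words of `L`
(to be distinguished from the `n`-fold concatenation of `L` with itself). -/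
def wordwisePow {α : Type*} (L : Language α) (n : ℕ) : Language α :=
  {u : List α | ∃ p ∈ L, u = wordPow p n}

/-- The class `FR` of the regular languages with a finite root. -/
def IsFR {α : Type*} (L : Language α) : Prop :=
  L.IsRegular ∧ Set.Finite (rootSet L : Set (List α))

end PrimitiveWords

/-! Write `K` for `L^(n)`, a context-free language of `n`-th powers, `n ≥ 2`. Let `q` be primitive
with `q^m ∈ K`. Pumping changes only a window of bounded length and gives some `r^n`. If `q` or `m`
is large, the unchanged part, read cyclically, has length at least `|q| + |r|`. A weak Fine–Wilf
theorem (`append_comm_of_wordPow_eq`) then makes conjugates of `q` and `r` commute, so `r^n` is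
again a power of `q` (`IsPrimitive.exists_eq_wordPow`).

Pumping down with `m ≥ 3` would delete a positive multiple of `|q|` letters, at most the pumping
constant; so `|q|` is bounded and the roots concerned are finitely many (`exists_length_root_le`).
Pumping up by a length chosen uniformly shows that the exponents of each `q` are eventually closed
under adding a constant (`exists_wordPow_add_mem`). They are therefore ultimately periodic, and the
language is a finite union of regular sets of powers. -/

namespace ContextFreeGrammar

/-! ### Parse forests and pumpable derivations -/

variable {T : Type*} {g : ContextFreeGrammar T}

/-- `g.Yields F k s w`: the sentential form `s` derives the terminal word `w` by a forest of parse
trees with `k` inner nodes, none of which is labelled with a nonterminal from `F`. -/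
inductive Yields (g : ContextFreeGrammar T) (F : Set g.NT) :
    ℕ → List (Symbol T g.NT) → List T → Prop
  | nil : Yields g F 0 [] []
  | terminal (a : T) {k s w} : Yields g F k s w → Yields g F k (.terminal a :: s) (a :: w)
  | nonterminal (r : ContextFreeRule T g.NT) {k l s u w} : r ∈ g.rules → r.input ∉ F →
      Yields g F k r.output u → Yields g F l s w →
      Yields g F (k + l + 1) (.nonterminal r.input :: s) (u ++ w)

/-- A word as a sentential form. -/
abbrev ofWord (g : ContextFreeGrammar T) (w : List T) : List (Symbol T g.NT) :=
  w.map Symbol.terminal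

lemma Derives.append {s s' t t' : List (Symbol T g.NT)} (h : g.Derives s s')
    (h' : g.Derives t t') : g.Derives (s ++ t) (s' ++ t') :=
  (h.append_right t).trans (h'.append_left s')

lemma derives_output {r : ContextFreeRule T g.NT} (hr : r ∈ g.rules) :
    g.Derives [.nonterminal r.input] r.output :=
  Produces.single ⟨r, hr, ContextFreeRule.Rewrites.input_output⟩

lemma Yields.derives {F : Set g.NT} {k : ℕ} {s : List (Symbol T g.NT)} {w : List T}
    (h : g.Yields F k s w) : g.Derives s (g.ofWord w) := by
  induction h with
  | nil => exact Derives.refl _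
  | terminal a _ ih => simpa [ofWord] using ih.append_left [Symbol.terminal a]
  | nonterminal r hr _ _ _ ih₁ ih₂ =>
    have := ((derives_output hr).trans ih₁).append ih₂
    simpa [ofWord] using this

lemma yields_ofWord (F : Set g.NT) (w : List T) : g.Yields F 0 (g.ofWord w) w := by
  induction w with
  | nil => exact .nil
  | cons a w ih => exact .terminal a ih

lemma Yields.append {F : Set g.NT} {k l : ℕ} {s t : List (Symbol T g.NT)} {u w : List T}
    (h : g.Yields F k s u) (h' : g.Yields F l t w) : g.Yields F (k + l) (s ++ t) (u ++ w) := by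
  induction h with
  | nil => simpa using h'
  | terminal a _ ih => exact .terminal a ih
  | @nonterminal r k₁ k₂ s u w hr hF h₁ _ _ ih =>
    have := Yields.nonterminal r hr hF h₁ ih
    rw [show k₁ + k₂ + 1 + l = k₁ + (k₂ + l) + 1 by omega]
    simpa using this

lemma Yields.exists_of_append {F : Set g.NT} (s : List (Symbol T g.NT)) :
    ∀ {k : ℕ} {t : List (Symbol T g.NT)} {w : List T}, g.Yields F k (s ++ t) w →
      ∃ k₁ k₂ w₁ w₂, g.Yields F k₁ s w₁ ∧ g.Yields F k₂ t w₂ ∧ w = w₁ ++ w₂ := by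
  induction s with
  | nil => intro k t w h; exact ⟨0, k, [], w, .nil, h, rfl⟩
  | cons x s ih =>
    intro k t w h
    rw [List.cons_append] at h
    cases h with
    | terminal a h =>
      obtain ⟨k₁, k₂, w₁, w₂, h₁, h₂, rfl⟩ := ih h
      exact ⟨k₁, k₂, a :: w₁, w₂, .terminal a h₁, h₂, rfl⟩
    | nonterminal r hr hF h h' =>
      obtain ⟨k₁, k₂, w₁, w₂, h₁, h₂, rfl⟩ := ih h'
      exact ⟨_, k₂, _, w₂, .nonterminal r hr hF h h₁, h₂, by simp⟩

lemma Derives.exists_yields {s : List (Symbol T g.NT)} {w : List T}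
    (h : g.Derives s (g.ofWord w)) : ∃ k, g.Yields ∅ k s w := by
  induction h using Relation.ReflTransGen.head_induction_on with
  | refl => exact ⟨0, yields_ofWord ∅ w⟩
  | head hp _ ih =>
    obtain ⟨k, hk⟩ := ih
    obtain ⟨r, hr, hrw⟩ := hp
    obtain ⟨p, q, rfl, rfl⟩ := hrw.exists_parts
    obtain ⟨k₁, k₂, w₁, w₂, h₁, h₂, rfl⟩ := Yields.exists_of_append _ hk
    obtain ⟨k₃, k₄, w₃, w₄, h₃, h₄, rfl⟩ := Yields.exists_of_append _ h₁
    have := (h₃.append (Yields.nonterminal r hr (by simp) h₄ .nil)).append h₂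
    exact ⟨_, by simpa using this⟩

/-- `s` derives `w` in such a way that the derivation passes through a context
`B ⇒ v B x` with `v x` nonempty. -/
def HasPump (g : ContextFreeGrammar T) (s : List (Symbol T g.NT)) (w : List T) : Prop :=
  ∃ (B : g.NT) (u v m x y : List T), w = u ++ v ++ m ++ x ++ y ∧ v ++ x ≠ [] ∧
    g.Derives s (g.ofWord u ++ [.nonterminal B] ++ g.ofWord y) ∧
    g.Derives [.nonterminal B] (g.ofWord v ++ [.nonterminal B] ++ g.ofWord x) ∧
    g.Derives [.nonterminal B] (g.ofWord m)

lemma HasPump.of_derives {s t : List (Symbol T g.NT)} {w : List T} (h : g.HasPump t w)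
    (hst : g.Derives s t) : g.HasPump s w := by
  obtain ⟨B, u, v, m, x, y, h₁, h₂, h₃, h₄⟩ := h
  exact ⟨B, u, v, m, x, y, h₁, h₂, hst.trans h₃, h₄⟩

lemma HasPump.append_left {s t : List (Symbol T g.NT)} {w z : List T} (h : g.HasPump s w)
    (ht : g.Derives t (g.ofWord z)) : g.HasPump (t ++ s) (z ++ w) := by
  obtain ⟨B, u, v, m, x, y, rfl, h₂, h₃, h₄⟩ := h
  exact ⟨B, z ++ u, v, m, x, y, by simp, h₂, by simpa [ofWord] using ht.append h₃, h₄⟩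

lemma HasPump.append_right {s t : List (Symbol T g.NT)} {w z : List T} (h : g.HasPump s w)
    (ht : g.Derives t (g.ofWord z)) : g.HasPump (s ++ t) (w ++ z) := by
  obtain ⟨B, u, v, m, x, y, rfl, h₂, h₃, h₄⟩ := h
  exact ⟨B, u, v, m, x, y ++ z, by simp, h₂, by simpa [ofWord] using h₃.append ht, h₄⟩

/-- Either no tree of the forest has an inner node labelled `A`, or there is a subtree with
root `A`. -/
lemma Yields.insert_or_exists_subtree {F : Set g.NT} (A : g.NT) {k : ℕ}
    {s : List (Symbol T g.NT)} {w : List T} (h : g.Yields F k s w) :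
    g.Yields (insert A F) k s w ∨ ∃ u m y k', w = u ++ m ++ y ∧
      g.Derives s (g.ofWord u ++ [.nonterminal A] ++ g.ofWord y) ∧
      k' ≤ k ∧ g.Yields F k' [.nonterminal A] m := by
  induction h with
  | nil => exact .inl .nil
  | terminal a _ ih =>
    rcases ih with ih | ⟨u, m, y, k', rfl, hd, hk, hy⟩
    · exact .inl (.terminal a ih)
    · exact .inr ⟨a :: u, m, y, k', by simp,
        by simpa [ofWord] using hd.append_left [Symbol.terminal a], hk, hy⟩
  | @nonterminal r k l s u w hr hF h₁ h₂ ih₁ ih₂ =>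
    by_cases hA : r.input = A
    · refine .inr ⟨[], u, w, k + 1, by simp, ?_, by omega, ?_⟩
      · simpa [ofWord, hA] using h₂.derives.append_left [Symbol.nonterminal A]
      · subst hA
        simpa using Yields.nonterminal r hr hF h₁ .nil
    · rcases ih₁ with ih₁ | ⟨u', m, y, k', rfl, hd, hk, hy⟩
      · rcases ih₂ with ih₂ | ⟨u', m, y, k', rfl, hd, hk, hy⟩
        · exact .inl (.nonterminal r hr (by simp [hA, hF]) ih₁ ih₂)
        · refine .inr ⟨u ++ u', m, y, k', by simp, ?_, by omega, hy⟩
          simpa [ofWord] using ((derives_output hr).trans h₁.derives).append hd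
      · refine .inr ⟨u', m, y ++ w, k', by simp, ?_, by omega, hy⟩
        simpa [ofWord] using ((derives_output hr).trans hd).append h₂.derives

/-- A pump inside one tree is a pump of the whole forest, so the bound `N` applies to each tree
separately. -/
lemma Yields.length_le_of_not_hasPump {F : Set g.NT} {N : ℕ}
    (hN : ∀ k A w, g.Yields F k [.nonterminal A] w → ¬ g.HasPump [.nonterminal A] w →
      w.length ≤ N) {k : ℕ} {s : List (Symbol T g.NT)} {w : List T} (h : g.Yields F k s w)
    (hp : ¬ g.HasPump s w) : w.length ≤ s.length * (N + 1) := by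
  induction h with
  | nil => simp
  | @terminal a k s w h ih =>
    have := ih fun h' ↦ hp (by
      simpa using h'.append_left (t := [.terminal a]) (z := [a]) (Derives.refl _))
    simp only [List.length_cons, add_mul]
    omega
  | @nonterminal r k l s u w hr hF h₁ h₂ ih₁ ih₂ =>
    have hd := (derives_output hr).trans h₁.derives
    have hw := ih₂ fun h' ↦ hp (by simpa using h'.append_left hd)
    have hu := hN (k + 0 + 1) r.input u (by simpa using Yields.nonterminal r hr hF h₁ .nil)
      fun h' ↦ hp (by simpa using h'.append_right h₂.derives)
    simp only [List.length_cons, List.length_append, add_mul]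
    omega

/-- A bound for the lengths of the right-hand sides of the rules. -/
def maxOutput (g : ContextFreeGrammar T) : ℕ :=
  g.rules.sup fun r ↦ r.output.length

lemma length_output_le {r : ContextFreeRule T g.NT} (hr : r ∈ g.rules) :
    r.output.length ≤ g.maxOutput :=
  Finset.le_sup (f := fun r : ContextFreeRule T g.NT ↦ r.output.length) hr

/-- Induction on the number `m` of nonterminals still allowed. If the root label does not recur
below the root, it can be forbidden in the children. If it recurs, the context between the two
occurrences is a pump unless it is empty. -/
lemma exists_length_le_of_not_hasPump (g : ContextFreeGrammar T) (m : ℕ) :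
    ∃ N, ∀ F : Set g.NT, ({A | ∃ r ∈ g.rules, r.input = A} \ F).ncard ≤ m →
      ∀ k A w, g.Yields F k [.nonterminal A] w → ¬ g.HasPump [.nonterminal A] w →
        w.length ≤ N := by
  have hfin : {A | ∃ r ∈ g.rules, r.input = A}.Finite :=
    g.rules.finite_toSet.image ContextFreeRule.input
  induction m with
  | zero =>
    refine ⟨0, fun F hF k A w h _ ↦ ?_⟩
    have h0 := (Set.ncard_eq_zero (hfin.subset Set.sdiff_subset)).1 (Nat.le_zero.1 hF)
    cases h with
    | nonterminal r hr hF' _ _ =>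
      have : r.input ∈ {A | ∃ r ∈ g.rules, r.input = A} \ F := ⟨⟨r, hr, rfl⟩, hF'⟩
      simp [h0] at this
  | succ m ih =>
    obtain ⟨N, hN⟩ := ih
    refine ⟨g.maxOutput * (N + 1), fun F hF k ↦ ?_⟩
    induction k using Nat.strong_induction_on with
    | _ k ihk =>
      intro A w h hp
      cases h with
      | @nonterminal r k l _ u w hr hF' h₁ h₂ =>
      cases h₂
      rw [List.append_nil] at hp ⊢
      rcases h₁.insert_or_exists_subtree r.input with h₁ | ⟨u', m', y, k', rfl, hd, hk, hy⟩
      · have hcard : ({A | ∃ r ∈ g.rules, r.input = A} \ insert r.input F).ncard ≤ m := by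
          have hlt : ({A | ∃ r ∈ g.rules, r.input = A} \ insert r.input F).ncard <
              ({A | ∃ r ∈ g.rules, r.input = A} \ F).ncard := by
            refine Set.ncard_lt_ncard ⟨fun B hB ↦ ⟨hB.1, fun h ↦ hB.2 (.inr h)⟩, fun h ↦ ?_⟩
              (hfin.subset Set.sdiff_subset)
            exact (h ⟨⟨r, hr, rfl⟩, hF'⟩).2 (.inl rfl)
          omega
        refine (h₁.length_le_of_not_hasPump (hN _ hcard)
          fun h ↦ hp (h.of_derives (derives_output hr))).trans ?_
        exact Nat.mul_le_mul_right _ (length_output_le hr)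
      -- With an empty context the smaller subtree has the same yield, so the induction on the tree
      -- size `k` applies.
      · by_cases huy : u' ++ y = []
        · obtain ⟨rfl, rfl⟩ := List.append_eq_nil_iff.1 huy
          refine ihk k' (by omega) _ _ (by simpa using hy) hp
        · exact absurd ⟨r.input, [], u', m', y, [], by simp, huy, Derives.refl _,
            (derives_output hr).trans hd, hy.derives⟩ hp

/-- Descend into a tree as long as its yield exceeds `g.maxOutput * (N + 1)`: some child then still
yields more than `N` letters. The upper bound keeps the pumping window short. -/
lemma Yields.exists_subtree_of_length (N : ℕ) {F : Set g.NT} {k : ℕ}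
    {s : List (Symbol T g.NT)} {w : List T} (h : g.Yields F k s w)
    (hw : s.length * (N + 1) < w.length) :
    ∃ A u m y k', w = u ++ m ++ y ∧
      g.Derives s (g.ofWord u ++ [.nonterminal A] ++ g.ofWord y) ∧
      g.Yields F k' [.nonterminal A] m ∧ N < m.length ∧
      m.length ≤ g.maxOutput * (N + 1) := by
  induction h with
  | nil => simp at hw
  | @terminal a k s w h ih =>
    obtain ⟨A, u, m, y, k', rfl, hd, h⟩ := ih (by
      simp only [List.length_cons, add_mul] at hw
      omega)
    exact ⟨A, a :: u, m, y, k', by simp,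
      by simpa [ofWord] using hd.append_left [Symbol.terminal a], h⟩
  | @nonterminal r k l s u w hr hF h₁ h₂ ih₁ ih₂ =>
    have hd₁ := (derives_output hr).trans h₁.derives
    by_cases hu : u.length ≤ N
    · obtain ⟨A, u', m, y, k', rfl, hd, h⟩ := ih₂ (by
        simp only [List.length_cons, List.length_append, add_mul] at hw
        omega)
      exact ⟨A, u ++ u', m, y, k', by simp, by simpa [ofWord] using hd₁.append hd, h⟩
    · by_cases hu' : u.length ≤ g.maxOutput * (N + 1)
      · refine ⟨r.input, [], u, w, _, by simp, ?_, by
          simpa using Yields.nonterminal r hr hF h₁ .nil, by omega, hu'⟩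
        simpa [ofWord] using h₂.derives.append_left [Symbol.nonterminal r.input]
      · have := Nat.mul_le_mul_right (N + 1) (length_output_le hr)
        obtain ⟨A, u', m, y, k', rfl, hd, h⟩ := ih₁ (by omega)
        exact ⟨A, u', m, y ++ w, k', by simp,
          by simpa [ofWord] using ((derives_output hr).trans hd).append h₂.derives, h⟩

end ContextFreeGrammar

namespace PrimitiveWords

variable {α : Type*}

@[simp]
lemma wordPow_zero (p : List α) : wordPow p 0 = [] := rfl

lemma wordPow_succ (p : List α) (n : ℕ) : wordPow p (n + 1) = p ++ wordPow p n := by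
  simp [wordPow, List.replicate_succ]

lemma wordPow_add (p : List α) (m n : ℕ) : wordPow p (m + n) = wordPow p m ++ wordPow p n := by
  rw [wordPow, List.replicate_add, List.flatten_append, wordPow, wordPow]

@[simp]
lemma wordPow_one (p : List α) : wordPow p 1 = p := by simp [wordPow]

lemma wordPow_succ' (p : List α) (n : ℕ) : wordPow p (n + 1) = wordPow p n ++ p := by
  simp [wordPow_add]

@[simp]
lemma length_wordPow (p : List α) (n : ℕ) : (wordPow p n).length = n * p.length := by
  simp [wordPow]

end PrimitiveWords

/-! ### The pumping lemma -/

open PrimitiveWords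

lemma ContextFreeGrammar.derives_wordPow {T : Type*} {g : ContextFreeGrammar T} {B : g.NT}
    {v x : List T}
    (h : g.Derives [.nonterminal B] (g.ofWord v ++ [.nonterminal B] ++ g.ofWord x)) (i : ℕ) :
    g.Derives [.nonterminal B]
      (g.ofWord (wordPow v i) ++ [.nonterminal B] ++ g.ofWord (wordPow x i)) := by
  induction i with
  | zero => exact Derives.refl _
  | succ i ih =>
    refine ih.trans ?_
    rw [wordPow_succ', wordPow_succ]
    simpa [ofWord] using (h.append_left (g.ofWord (wordPow v i))).append_right
      (g.ofWord (wordPow x i))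

/-- The **pumping lemma** for context-free languages. -/
theorem Language.IsContextFree.pumping_lemma {T : Type*} {L : Language T} (hL : L.IsContextFree) :
    ∃ N, ∀ w ∈ L, N < w.length → ∃ u v m x y, w = u ++ (v ++ m ++ x) ++ y ∧
      (v ++ m ++ x).length ≤ N ∧ v ++ x ≠ [] ∧
      ∀ i, u ++ (wordPow v i ++ m ++ wordPow x i) ++ y ∈ L := by
  obtain ⟨g, rfl⟩ := hL
  obtain ⟨N, hN⟩ := g.exists_length_le_of_not_hasPump
    ({A | ∃ r ∈ g.rules, r.input = A} \ ∅).ncard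
  refine ⟨max (N + 1) (g.maxOutput * (N + 1)), fun w hw hlen ↦ ?_⟩
  obtain ⟨k, hk⟩ := ContextFreeGrammar.Derives.exists_yields hw
  obtain ⟨A, u, z, y, k', rfl, hd, hz, hNz, hz'⟩ := hk.exists_subtree_of_length N (by
    simp only [List.length_cons, List.length_nil]
    omega)
  have hp : g.HasPump [.nonterminal A] z := by
    by_contra hp
    have := hN ∅ le_rfl _ _ _ hz hp
    omega
  obtain ⟨B, u', v, m, x, y', rfl, hvx, hA, hB, hm⟩ := hp
  refine ⟨u ++ u', v, m, x, y' ++ y, by simp, ?_, hvx, fun i ↦ ?_⟩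
  · simp only [List.length_append] at hz' ⊢
    omega
  · have h₁ := hd.trans ((hA.append_left (g.ofWord u)).append_right (g.ofWord y))
    have h₂ := (ContextFreeGrammar.derives_wordPow hB i).trans
      ((hm.append_left (g.ofWord (wordPow v i))).append_right (g.ofWord (wordPow x i)))
    have h₃ := h₁.trans (by
      simpa [ContextFreeGrammar.ofWord] using
        (h₂.append_left (g.ofWord (u ++ u'))).append_right (g.ofWord (y' ++ y)))
    rw [ContextFreeGrammar.mem_language_iff]
    simpa [ContextFreeGrammar.ofWord] using h₃

/-! ### Combinatorics on words: conjugation, commutation, primitivity -/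

namespace PrimitiveWords

variable {α : Type*}

@[simp]
lemma wordPow_nil (n : ℕ) : wordPow ([] : List α) n = [] := by simp [wordPow]

lemma wordPow_mul (p : List α) (m n : ℕ) : wordPow p (m * n) = wordPow (wordPow p m) n := by
  induction n with
  | zero => simp
  | succ n ih => rw [Nat.mul_succ, wordPow_add, ih, wordPow_succ']

lemma wordPow_append_comm (x y : List α) (m : ℕ) :
    wordPow (x ++ y) m ++ x = x ++ wordPow (y ++ x) m := by
  induction m with
  | zero => simp
  | succ m ih => rw [wordPow_succ, wordPow_succ]; simp [ih]

lemma rotate_wordPow (q : List α) (m k : ℕ) :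
    (wordPow q m).rotate k = wordPow (q.rotate k) m := by
  induction k generalizing q with
  | zero => simp
  | succ k ih =>
    cases q with
    | nil => simp
    | cons a l =>
      cases m with
      | zero => simp
      | succ m =>
        rw [List.rotate_cons_succ, ← ih, wordPow_succ, List.cons_append, List.rotate_cons_succ]
        congr 1
        have := wordPow_append_comm [a] l m
        rw [List.singleton_append] at this
        rw [wordPow_succ, List.append_assoc, this, List.append_assoc]

lemma wordPow_left_injective {n : ℕ} (hn : n ≠ 0) {p q : List α}
    (h : wordPow p n = wordPow q n) : p = q := by
  have hlen : p.length = q.length := by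
    have := congrArg List.length h
    simpa [hn] using this
  obtain ⟨n, rfl⟩ := Nat.exists_eq_succ_of_ne_zero hn
  rw [wordPow_succ, wordPow_succ] at h
  exact (List.append_inj h hlen).1

/-- Euclid's algorithm: the shorter word is a prefix of the longer one, and cancelling it leaves a
commuting pair. -/
lemma exists_eq_wordPow_of_append_comm {q r : List α} (h : q ++ r = r ++ q) :
    ∃ (w : List α) (a b : ℕ), q = wordPow w a ∧ r = wordPow w b := by
  obtain ⟨n, hn⟩ : ∃ n, n = q.length + r.length := ⟨_, rfl⟩
  induction n using Nat.strong_induction_on generalizing q r with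
  | _ n ih =>
    wlog hqr : q.length ≤ r.length generalizing q r with H
    · obtain ⟨w, a, b, hr, hq⟩ := H h.symm (by omega) (by omega)
      exact ⟨w, b, a, hq, hr⟩
    by_cases hq : q = []
    · exact ⟨r, 0, 1, by simpa using hq, by simp⟩
    · obtain ⟨r, rfl⟩ : q <+: r :=
        List.prefix_of_prefix_length_le (h ▸ List.prefix_append q r) (List.prefix_append r q) hqr
      have hpos := List.length_pos_of_ne_nil hq
      rw [List.append_assoc, List.append_right_inj] at h
      obtain ⟨w, a, b, hq', rfl⟩ := ih _ (by simp at hn; omega) h rfl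
      exact ⟨w, a, a + b, hq', by rw [wordPow_add, ← hq']⟩

/-- Weak Fine–Wilf: by periodicity the prefix of `c` of length `|q| + |r|` reads both as `q ++ r`
and as `r ++ q`. -/
lemma append_comm_of_wordPow_eq {q r c s s' : List α} {m n : ℕ} (hq : wordPow q m = c ++ s)
    (hr : wordPow r n = c ++ s') (hc : q.length + r.length ≤ c.length) : q ++ r = r ++ q := by
  have key : ∀ {x y t : List α} {k : ℕ}, wordPow x k = c ++ t →
      x.length + y.length ≤ c.length → c.take (x.length + y.length) = x ++ c.take y.length := by
    intro x y t k hx hxy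
    cases k with
    | zero =>
      have hc : c = [] := (List.append_eq_nil_iff.1 hx.symm).1
      subst hc
      simp at hxy
      simp [hxy.1]
    | succ k =>
      have hk := congrArg List.length hx
      have h₁ : c.take (x.length + y.length) = (wordPow x (k + 1)).take (x.length + y.length) := by
        rw [hx, List.take_append_of_le_length hxy]
      have h₂ : c.take y.length = (wordPow x (k + 1)).take y.length := by
        rw [hx, List.take_append_of_le_length (by omega)]
      rw [h₁, h₂, wordPow_succ, List.take_length_add_append, ← wordPow_succ, wordPow_succ',
        List.take_append_of_le_length]
      simp only [length_wordPow, List.length_append, add_mul] at hk ⊢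
      omega
  have take_eq : ∀ {x y t : List α} {k : ℕ}, wordPow x k = c ++ t →
      x.length + y.length ≤ c.length → c.take x.length = x := by
    intro x y t k hx hxy
    cases k with
    | zero =>
      have hc : c = [] := (List.append_eq_nil_iff.1 hx.symm).1
      subst hc
      simp at hxy
      simp [hxy.1]
    | succ k =>
      rw [← List.take_append_of_le_length (l₂ := t) (by omega : x.length ≤ c.length), ← hx,
        wordPow_succ]
      simp
  have h₁ := key hq hc
  have h₂ := key hr (y := q) (by omega)
  rw [take_eq hr (y := q) (by omega)] at h₁
  rw [take_eq hq hc] at h₂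
  rw [← h₁, ← h₂, add_comm]

lemma IsPrimitive.ne_nil {q : List α} (hq : IsPrimitive q) : q ≠ [] := hq.1

lemma IsPrimitive.eq_one_of_eq_wordPow {q w : List α} (hq : IsPrimitive q) {a : ℕ}
    (h : q = wordPow w a) : a = 1 := by
  have h0 : a ≠ 0 := by
    rintro rfl
    exact hq.1 h
  by_contra h1
  exact hq.2 ⟨hq.1, w, a, by omega, h⟩

/-- If replacing a short factor in a power of a primitive word `q` yields a power of a word which
is not too long, then the result is again a power of `q`. -/
lemma IsPrimitive.exists_eq_wordPow {q r u s s' y : List α} {m n : ℕ} (hq : IsPrimitive q)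
    (h : wordPow q m = u ++ s ++ y) (h' : wordPow r n = u ++ s' ++ y)
    (hlen : q.length + r.length ≤ u.length + y.length) :
    ∃ j, u ++ s' ++ y = wordPow q (j * n) := by
  have hm : m ≠ 0 := by
    rintro rfl
    have := congrArg List.length h
    have := List.length_pos_of_ne_nil hq.1
    simp at *
    omega
  -- Rotation joins the two unchanged pieces into a common prefix `y ++ u`; rotating by `|y|` later
  -- undoes it.
  have h₁ : wordPow (q.rotate (u ++ s).length) m = (y ++ u) ++ s := by
    rw [← rotate_wordPow, h, List.rotate_append_length_eq, List.append_assoc]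
  have h₂ : wordPow (r.rotate (u ++ s').length) n = (y ++ u) ++ s' := by
    rw [← rotate_wordPow, h', List.rotate_append_length_eq, List.append_assoc]
  obtain ⟨w, a, b, ha, hb⟩ := exists_eq_wordPow_of_append_comm
    (append_comm_of_wordPow_eq h₁ h₂ (by simp; omega))
  have hqw : q = wordPow (w.rotate y.length) a := by
    refine wordPow_left_injective hm ?_
    rw [← rotate_wordPow, ← ha, ← rotate_wordPow, h₁, h, List.append_assoc y u s,
      List.rotate_append_length_eq]
  obtain rfl := hq.eq_one_of_eq_wordPow hqw
  rw [wordPow_one] at hqw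
  refine ⟨b, ?_⟩
  rw [wordPow_mul, hqw, ← rotate_wordPow, ← hb, ← rotate_wordPow, h₂, List.append_assoc y u s',
    List.rotate_append_length_eq]

lemma exists_isRootOf {p : List α} (hp : p ≠ []) : ∃ q, IsRootOf q p := by
  obtain ⟨n, hn⟩ : ∃ n, n = p.length := ⟨_, rfl⟩
  induction n using Nat.strong_induction_on generalizing p with
  | _ n ih =>
    by_cases h : IsPeriodic p
    · obtain ⟨-, v, k, hk, rfl⟩ := h
      have hv : v ≠ [] := by
        rintro rfl
        simp at hp
      have hpos := List.length_pos_of_ne_nil hv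
      obtain ⟨q, hq, m, rfl⟩ := ih v.length (by rw [hn, length_wordPow]; nlinarith) hv rfl
      exact ⟨q, hq, m * k, (wordPow_mul q m k).symm⟩
    · exact ⟨p, ⟨hp, h⟩, 1, by simp⟩

/-! ### Pumping in a language of `n`-th powers -/

/-- If a context-free language consists of `n`-th powers with `n ≥ 2`, then the primitive words
having a third or higher power in the language are of bounded length. -/
lemma exists_length_root_le {K : Language α} (hK : K.IsContextFree) {n : ℕ} (hn : 2 ≤ n)
    (hpow : ∀ w ∈ K, ∃ r, w = wordPow r n) :
    ∃ C, ∀ q, IsPrimitive q → ∀ m, 3 ≤ m → wordPow q m ∈ K → q.length ≤ C := by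
  obtain ⟨N, hN⟩ := hK.pumping_lemma
  -- Since `2|r| ≤ m|q|` and `m ≥ 3`, having `|q| > 2N` leaves at least `|q| + |r|` letters outside
  -- the window.
  refine ⟨2 * N, fun q hq m hm hqm ↦ ?_⟩
  by_contra! hlt
  have h3 : 3 * q.length ≤ m * q.length := Nat.mul_le_mul_right _ hm
  obtain ⟨u, v, z, x, y, hw, hvzx, hvx, hpump⟩ := hN _ hqm (by rw [length_wordPow]; omega)
  have h0 := hpump 0
  obtain ⟨r, hr⟩ := hpow _ h0
  have hlen := congrArg List.length hw
  have hlen' := congrArg List.length hr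
  have h2 : 2 * r.length ≤ n * r.length := Nat.mul_le_mul_right _ hn
  have hd := List.length_pos_of_ne_nil hvx
  simp only [wordPow_zero, List.nil_append, List.append_nil, List.length_append,
    length_wordPow] at hlen hlen' hvzx hd
  obtain ⟨j, hj⟩ := hq.exists_eq_wordPow hw hr.symm (by omega)
  have hlen'' := congrArg List.length hj
  simp only [wordPow_zero, List.nil_append, List.append_nil, List.length_append,
    length_wordPow] at hlen''
  -- The number of deleted letters is positive, at most `N`, and divisible by `|q| > 2N`.
  have hdvd : q.length ∣ m * q.length - j * n * q.length :=
    Nat.dvd_sub (Nat.dvd_mul_left _ _) (Nat.dvd_mul_left _ _)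
  have := Nat.le_of_dvd (by omega) hdvd
  omega

/-- If a context-free language consists of `n`-th powers with `n ≥ 2`, then the set of the
exponents of the powers of a primitive word in the language is eventually closed under the
addition of a positive multiple of `n`. -/
lemma exists_wordPow_add_mem {K : Language α} (hK : K.IsContextFree) {n : ℕ} (hn : 2 ≤ n)
    (hpow : ∀ w ∈ K, ∃ r, w = wordPow r n) :
    ∃ D M, 0 < D ∧ ∀ q, IsPrimitive q → ∀ m, M ≤ m → wordPow q m ∈ K →
      wordPow q (m + n * D) ∈ K := by
  obtain ⟨N, hN⟩ := hK.pumping_lemma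
  refine ⟨N.factorial, 2 + 2 * N.factorial + 2 * N, N.factorial_pos, fun q hq m hm hqm ↦ ?_⟩
  have hpos := List.length_pos_of_ne_nil hq.ne_nil
  have hmq := Nat.mul_le_mul_right q.length hm
  have hNq : N ≤ N * q.length := Nat.le_mul_of_pos_right _ hpos
  simp only [add_mul, mul_assoc] at hmq
  obtain ⟨u, v, z, x, y, hw, hvzx, hvx, hpump⟩ := hN _ hqm (by rw [length_wordPow]; omega)
  have hd := List.length_pos_of_ne_nil hvx
  have hlen := congrArg List.length hw
  simp only [List.length_append, length_wordPow] at hlen hvzx hd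
  obtain ⟨e, he⟩ := Nat.dvd_factorial hd (by omega : v.length + x.length ≤ N)
  -- As `|vx| * e = N!`, this adds exactly `n * N! * |q|` letters, whatever `v` and `x` are.
  have hi := hpump (1 + n * e * q.length)
  obtain ⟨r, hr⟩ := hpow _ hi
  have hlt : (u ++ (wordPow v (1 + n * e * q.length) ++ z ++ wordPow x (1 + n * e * q.length)) ++
      y).length = (m + n * N.factorial) * q.length := by
    simp only [List.length_append, length_wordPow, add_mul, one_mul]
    rw [hlen, he]
    ring
  have hlen' := hlt
  rw [hr, length_wordPow, add_mul, mul_assoc n] at hlen'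
  have hr2 : 2 * r.length ≤ m * q.length + 2 * (N.factorial * q.length) := by
    by_cases hle : r.length ≤ N.factorial * q.length
    · omega
    · obtain ⟨e', he'⟩ := Nat.exists_eq_add_of_lt (not_le.1 hle)
      rw [he', add_assoc, mul_add] at hlen'
      have := Nat.mul_le_mul_right (e' + 1) hn
      omega
  obtain ⟨j, hj⟩ := hq.exists_eq_wordPow hw hr.symm (by omega)
  have hjn : j * n = m + n * N.factorial := by
    rw [hj, length_wordPow] at hlt
    exact Nat.eq_of_mul_eq_mul_right hpos hlt
  rw [← hjn, ← hj]
  exact hi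

/-! ### Ultimately periodic exponents and regularity -/

/-- A set of numbers which is eventually closed under adding `D` is eventually periodic. -/
lemma exists_forall_add_mem_iff {S : Set ℕ} {D M : ℕ} (hD : 0 < D)
    (hS : ∀ k, M ≤ k → k ∈ S → k + D ∈ S) : ∃ M', ∀ k, M' ≤ k → (k + D ∈ S ↔ k ∈ S) := by
  have hmul : ∀ t k, M ≤ k → k ∈ S → k + t * D ∈ S := by
    intro t
    induction t with
    | zero => simp
    | succ t ih =>
      intro k hk hkS
      rw [Nat.succ_mul, ← add_assoc]
      exact hS _ (by omega) (ih k hk hkS)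
  -- Beyond `M`, a residue class either misses `S` or lies in `S` from some element on.
  have hres : ∀ c, ∃ b, ∀ k, b ≤ k → k % D = c → k + D ∈ S → k ∈ S := by
    intro c
    by_cases h : ∃ b, M ≤ b ∧ b ∈ S ∧ b % D = c
    · obtain ⟨b, hMb, hbS, hbc⟩ := h
      refine ⟨b, fun k hk hkc _ ↦ ?_⟩
      obtain ⟨t, ht⟩ := (Nat.modEq_iff_dvd' hk).1 (hbc.trans hkc.symm)
      have := hmul t b hMb hbS
      rwa [mul_comm, ← ht, Nat.add_sub_cancel' hk] at this
    · refine ⟨M, fun k hk hkc hkS ↦ (h ⟨k + D, by omega, hkS, by simpa using hkc⟩).elim⟩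
  choose b hb using hres
  refine ⟨M + (Finset.range D).sup b, fun k hk ↦ ⟨fun h ↦ ?_, hS k (by omega)⟩⟩
  have : b (k % D) ≤ (Finset.range D).sup b :=
    Finset.le_sup (Finset.mem_range.2 (Nat.mod_lt k hD))
  exact hb _ k (by omega) rfl h

/-- The powers of a word with exponents in an eventually periodic set form a regular language. -/
lemma isRegular_of_forall_add_mem_iff {q : List α} (hq : q ≠ []) {S : Set ℕ} {D M : ℕ}
    (hD : 0 < D) (hS : ∀ k, M ≤ k → (k + D ∈ S ↔ k ∈ S)) {Q : Language α}
    (hQ : ∀ w, w ∈ Q ↔ ∃ k ∈ S, w = wordPow q k) : Q.IsRegular := by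
  have hpos := List.length_pos_of_ne_nil hq
  have hshift : ∀ a b, M ≤ a → Q.leftQuotient (wordPow q (a + D) ++ q.take b) =
      Q.leftQuotient (wordPow q a ++ q.take b) := by
    intro a b ha
    ext y
    simp only [Language.mem_leftQuotient, hQ]
    constructor
    · rintro ⟨k, hk, h⟩
      have hak : a + D ≤ k := by
        have := congrArg List.length h
        simp only [List.length_append, length_wordPow] at this
        exact Nat.le_of_mul_le_mul_right (by omega : (a + D) * q.length ≤ k * q.length) hpos
      obtain ⟨c, rfl⟩ := Nat.exists_eq_add_of_le hak
      refine ⟨a + c, (hS _ (by omega)).1 (by rwa [add_right_comm]), ?_⟩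
      rw [add_comm a D, add_assoc, wordPow_add, wordPow_add] at h
      simpa using h
    · rintro ⟨k, hk, h⟩
      have hak : a ≤ k := by
        have := congrArg List.length h
        simp only [List.length_append, length_wordPow] at this
        exact Nat.le_of_mul_le_mul_right (by omega : a * q.length ≤ k * q.length) hpos
      refine ⟨k + D, (hS _ (by omega)).2 hk, ?_⟩
      rw [add_comm k, add_comm a, wordPow_add, wordPow_add, ← h]
      simp
  have hred : ∀ a b, ∃ a' < M + D, Q.leftQuotient (wordPow q a ++ q.take b) =
      Q.leftQuotient (wordPow q a' ++ q.take b) := by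
    intro a b
    induction a using Nat.strong_induction_on with
    | _ a ih =>
      by_cases ha : a < M + D
      · exact ⟨a, ha, rfl⟩
      · obtain ⟨a', ha', h⟩ := ih (a - D) (by omega)
        refine ⟨a', ha', ?_⟩
        rw [← h, ← hshift (a - D) b (by omega), Nat.sub_add_cancel (by omega)]
  -- Myhill–Nerode: a nonzero left quotient comes from a prefix `q^a ++ q.take b` of a power of `q`,
  -- and `a` can be reduced below `M + D`.
  refine Language.IsRegular.of_finite_range_leftQuotient (Set.Finite.subset
    ((((Set.finite_lt_nat (M + D)).prod (Set.finite_le_nat q.length)).image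
      fun p ↦ Q.leftQuotient (wordPow q p.1 ++ q.take p.2)).insert (0 : Language α)) ?_)
  rintro _ ⟨x, rfl⟩
  by_cases hx : Q.leftQuotient x = 0
  · exact .inl hx
  · right
    obtain ⟨y, hy⟩ : ∃ y, y ∈ Q.leftQuotient x := by
      by_contra! h
      exact hx (Language.ext fun y ↦ by simp [h y])
    obtain ⟨k, -, hk⟩ := (hQ _).1 hy
    obtain ⟨a, b, hb, rfl⟩ : ∃ a b, b ≤ q.length ∧ x = wordPow q a ++ q.take b := by
      clear hx hy
      induction k generalizing x with
      | zero => exact ⟨0, 0, by omega, by simp_all⟩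
      | succ k ih =>
        rw [wordPow_succ] at hk
        rcases List.append_eq_append_iff.1 hk with ⟨c, rfl, -⟩ | ⟨c, rfl, hc⟩
        · exact ⟨0, x.length, by simp, by simp⟩
        · obtain ⟨a, b, hb, rfl⟩ := ih c hc.symm
          exact ⟨a + 1, b, hb, by simp [wordPow_succ]⟩
    obtain ⟨a', ha', h⟩ := hred a b
    exact ⟨(a', b), ⟨ha', hb⟩, h.symm⟩

lemma isRegular_of_subset_singleton_nil {Q : Language α} (hQ : ∀ w ∈ Q, w = []) :
    Q.IsRegular := by
  refine Language.IsRegular.of_finite_range_leftQuotient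
    (((Set.finite_singleton Q).insert (0 : Language α)).subset ?_)
  rintro _ ⟨x, rfl⟩
  cases x with
  | nil => exact .inr rfl
  | cons a x => exact .inl (Language.ext fun y ↦ by
      simpa using fun h ↦ by simpa using hQ _ h)

lemma isRegular_of_forall_mem_iff_exists {ι : Type*} (s : Finset ι) {f : ι → Language α}
    (hf : ∀ i ∈ s, (f i).IsRegular) {Q : Language α} (hQ : ∀ w, w ∈ Q ↔ ∃ i ∈ s, w ∈ f i) :
    Q.IsRegular := by
  classical
  obtain rfl : Q = ∑ i ∈ s, f i := by
    refine Language.ext fun w ↦ (hQ w).trans ?_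
    clear hQ hf
    induction s using Finset.induction_on with
    | empty => simp
    | insert i s hi ih => simp [Finset.sum_insert hi, Language.mem_add, ih]
  clear hQ
  induction s using Finset.induction_on with
  | empty => exact isRegular_of_subset_singleton_nil (by simp)
  | insert i s hi ih =>
    rw [Finset.sum_insert hi]
    exact (hf i (by simp)).add (ih fun j hj ↦ hf j (by simp [hj]))

/-- A language whose roots have bounded length and which is eventually closed under the addition
of a fixed positive number to the exponents of its words is regular and has a finite root. -/
lemma isFR_of_length_root_le [Finite α] {L : Language α} {C D M : ℕ} (hD : 0 < D)
    (hC : ∀ q, IsPrimitive q → ∀ k, 1 ≤ k → wordPow q k ∈ L → q.length ≤ C)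
    (hM : ∀ q, IsPrimitive q → ∀ k, M ≤ k → wordPow q k ∈ L → wordPow q (k + D) ∈ L) :
    IsFR L := by
  have hfin : {q : List α | IsPrimitive q ∧ q.length ≤ C}.Finite :=
    (List.finite_length_le α C).subset fun q hq ↦ hq.2
  have hroot : ∀ p ∈ L, p ≠ [] → ∀ q, IsRootOf q p → IsPrimitive q ∧ q.length ≤ C := by
    rintro p hp hp0 q ⟨hq, k, rfl⟩
    refine ⟨hq, hC q hq k ?_ hp⟩
    by_contra! hk
    obtain rfl : k = 0 := by omega
    exact hp0 rfl
  refine ⟨?_, hfin.subset ?_⟩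
  · let powers (q : List α) : Language α := {w | ∃ k ∈ {k | wordPow q k ∈ L}, w = wordPow q k}
    -- The empty word has no root, so it is treated separately.
    let nil : Language α := {w | w ∈ L ∧ w = []}
    let rest : Language α := {w | ∃ q ∈ hfin.toFinset, w ∈ powers q}
    have hnil : nil.IsRegular := isRegular_of_subset_singleton_nil fun w hw ↦ hw.2
    have hrest : rest.IsRegular := by
      refine isRegular_of_forall_mem_iff_exists hfin.toFinset (f := powers) (fun q hq ↦ ?_)
        fun w ↦ Iff.rfl
      have hq' : IsPrimitive q := (hfin.mem_toFinset.1 hq).1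
      obtain ⟨M', hM'⟩ := exists_forall_add_mem_iff (S := {k | wordPow q k ∈ L}) hD
        fun k hk hkL ↦ hM q hq' k hk hkL
      exact isRegular_of_forall_add_mem_iff hq'.ne_nil hD hM' fun w ↦ Iff.rfl
    convert hnil.add hrest using 1
    refine Language.ext fun w ↦ ⟨fun hw ↦ ?_, ?_⟩
    · by_cases hw0 : w = []
      · exact .inl ⟨hw, hw0⟩
      · obtain ⟨q, hq⟩ := exists_isRootOf hw0
        obtain ⟨k, rfl⟩ := hq.2
        exact .inr ⟨q, hfin.mem_toFinset.2 (hroot _ hw hw0 q hq), k, hw, rfl⟩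
    · rintro (hw | ⟨q, -, k, hk, rfl⟩)
      · exact hw.1
      · exact hk
  · rintro q ⟨p, hp, hp0, hqp⟩
    exact hroot p hp hp0 q hqp

lemma wordPow_mul_mem_wordwisePow_iff {L : Language α} {n : ℕ} (hn : n ≠ 0) (q : List α) (k : ℕ) :
    wordPow q (k * n) ∈ wordwisePow L n ↔ wordPow q k ∈ L := by
  constructor
  · rintro ⟨p, hp, h⟩
    rw [wordPow_mul] at h
    rwa [wordPow_left_injective hn h]
  · exact fun h ↦ ⟨_, h, wordPow_mul q k n⟩

lemma IsPrimitive.wordPow_mem_per_iff {q : List α} (hq : IsPrimitive q) (k : ℕ) :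
    wordPow q k ∈ Per α ↔ 2 ≤ k := by
  constructor
  · intro h
    by_contra! hk
    interval_cases k
    · exact h.1 rfl
    · exact hq.2 (by rwa [wordPow_one] at h)
  · intro h
    refine ⟨fun h0 ↦ ?_, q, k, h, rfl⟩
    have := congrArg List.length h0
    simp [hq.ne_nil] at this
    omega

end PrimitiveWords

theorem theorem40 {α : Type*} [Finite α] (L : Language α) (hL : L.IsContextFree)
    (n : ℕ) (hn : 2 ≤ n) (hLn : (PrimitiveWords.wordwisePow L n).IsContextFree) :
    (3 ≤ n → PrimitiveWords.IsFR L) ∧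
      (n = 2 → PrimitiveWords.IsFR (L ⊓ PrimitiveWords.Per α)) := by
  have hpow : ∀ w ∈ wordwisePow L n, ∃ r, w = wordPow r n := fun w ⟨p, _, h⟩ ↦ ⟨p, h⟩
  have hn0 : n ≠ 0 := by omega
  obtain ⟨C, hC⟩ := exists_length_root_le hLn hn hpow
  obtain ⟨D, M, hD, hM⟩ := exists_wordPow_add_mem hLn hn hpow
  have hM' : ∀ q, IsPrimitive q → ∀ k, M ≤ k → wordPow q k ∈ L → wordPow q (k + D) ∈ L := by
    intro q hq k hk hkL
    rw [← wordPow_mul_mem_wordwisePow_iff hn0] at hkL ⊢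
    rw [add_mul, mul_comm D]
    exact hM q hq _ (hk.trans (Nat.le_mul_of_pos_right _ (by omega))) hkL
  refine ⟨fun hn3 ↦ isFR_of_length_root_le (C := C) hD (fun q hq k hk hkL ↦ ?_) hM', ?_⟩
  · exact hC q hq (k * n) (by nlinarith) ((wordPow_mul_mem_wordwisePow_iff hn0 q k).2 hkL)
  · rintro rfl
    refine isFR_of_length_root_le (C := C) (M := M) hD (fun q hq k hk hkL ↦ ?_)
      fun q hq k hk hkL ↦ ?_
    · have := (hq.wordPow_mem_per_iff k).1 hkL.2
      -- Here periodicity is needed: `k = 1` would give only the exponent 2, below the required 3.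
      exact hC q hq (k * 2) (by omega) ((wordPow_mul_mem_wordwisePow_iff hn0 q k).2 hkL.1)
    · have := (hq.wordPow_mem_per_iff k).1 hkL.2
      exact ⟨hM' q hq k hk hkL.1, (hq.wordPow_mem_per_iff _).2 (by omega)⟩
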